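/- Let $d\ge 1$ and let $\Lambda$ be a stationary random Borel measure on $\mathbb{R}^d$ (a random element of the space of Borel measures with the $\sigma$-algebra generated by the evaluations), normalized so that $\mathbb{E}[\Lambda([0,1]^d)]=1$. Let $\lambda>0$ and let $X=(X_i)_{i\in I}$ be a Cox point process with intensity measure $\lambda\Lambda$; that is, conditionally on $\Lambda$, $X$ is a Poisson point process with intensity measure $\lambda\Lambda$. Let $(\varrho_i)_{i\in I}$ be i.i.d. nonnegative radii, distributed as a random variable $\varrho$ and independent of $(\Lambda,X)$, and let $$\mathcal{C}=\bigcup_{i\in I}B_{\varrho_i}(X_i)$$ be the associated Boolean model, where $B_r(x)=\{y\in\mathbb{R}^d\colon |x-y|<r\}$. If $\mathbb{E}[\varrho^d]<\infty$, then, for every $\lambda>0$, $\mathbb{P}(\mathcal{C}=\mathbb{R}^d)<1$. If, in addition, $\Lambda$ is ergodic, meaning that $\mathbb{P}(\Lambda\in E)\in\{0,1\}$ for every measurable translation-invariant set $E$ of Borel measures on $\mathbb{R}^d$, then $\mathbb{P}(\mathcal{C}=\mathbb{R}^d)=0$ for every $\lambda>0$. -/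

import Mathlib

open MeasureTheory ProbabilityTheory
open scoped NNReal ENNReal

namespace CoxBoolean

/-- The Euclidean space of dimension `d`. -/
abbrev Space (d : ℕ) : Type := EuclideanSpace ℝ (Fin d)

/-- The closed unit cube `[0,1]^d`. -/
def unitCube (d : ℕ) : Set (Space d) := {x | ∀ i, x i ∈ Set.Icc (0 : ℝ) 1}

/-- The translate of the measure `m` by the vector `x`. -/
noncomputable def translateMeasure {d : ℕ} (x : Space d) (m : Measure (Space d)) : Measure (Space d) :=
  m.map (fun y => y + x)

/-- `Λ` is a stationary random measure (a random element of the space of Borel measures, with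
the sigma-algebra generated by the evaluations) whose expected mass on the unit cube is one. -/
structure IsStationaryNormalized {d : ℕ} {Ω : Type*} [MeasurableSpace Ω] (P : Measure Ω)
    (Λ : Ω → Measure (Space d)) : Prop where
  measurable : Measurable Λ
  stationary : ∀ x : Space d, P.map (fun ω => translateMeasure x (Λ ω)) = P.map Λ
  normalized : ∫⁻ ω, Λ ω (unitCube d) ∂P = 1

/-- Ergodicity of a random measure: every measurable translation-invariant set of measures has
probability zero or one. -/
def IsErgodic {d : ℕ} {Ω : Type*} [MeasurableSpace Ω] (P : Measure Ω)
    (Λ : Ω → Measure (Space d)) : Prop :=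
  ∀ E : Set (Measure (Space d)), MeasurableSet E → (∀ x : Space d, translateMeasure x ⁻¹' E = E) →
    P (Λ ⁻¹' E) = 0 ∨ P (Λ ⁻¹' E) = 1

/-- The probability that a Poisson random variable with mean `m` equals the natural number `n`;
a Poisson random variable with infinite mean is infinite almost surely. -/
noncomputable def poissonProb (m : ℝ≥0∞) (n : ℕ) : ℝ≥0∞ :=
  if m = ∞ then 0 else poissonMeasure m.toNNReal {n}

/-- The number, with multiplicity, of points of the family `(x i)`, `i < k`, that lie in `A`. -/
noncomputable def pointCount {d : ℕ} (k : ℕ∞) (x : ℕ → Space d) (A : Set (Space d)) : ℕ∞ :=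
  Set.encard {i : ℕ | (i : ℕ∞) < k ∧ x i ∈ A}

/-- The random points `X i`, `i < N`, form a Cox point process with intensity measure `lam * Λ`:
conditionally on `Λ`, the numbers of points in disjoint Borel sets are independent Poisson random
variables whose means are the masses of these sets under `lam * Λ`. -/
structure IsCoxProcess {d : ℕ} {Ω : Type*} [MeasurableSpace Ω] (P : Measure Ω)
    (Λ : Ω → Measure (Space d)) (lam : ℝ≥0) (N : Ω → ℕ∞) (X : ℕ → Ω → Space d) : Prop where
  measurable_number : Measurable N
  measurable_point : ∀ i, Measurable (X i)
  conditional_law : ∀ (k : ℕ) (A : Fin k → Set (Space d)), (∀ j, MeasurableSet (A j)) →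
    Pairwise (fun i j => Disjoint (A i) (A j)) → ∀ (n : Fin k → ℕ) (D : Set (Measure (Space d))),
    MeasurableSet D →
      P {ω | Λ ω ∈ D ∧ ∀ j, pointCount (N ω) (fun i => X i ω) (A j) = n j} =
        ∫⁻ ω in Λ ⁻¹' D, ∏ j, poissonProb ((lam : ℝ≥0∞) * Λ ω (A j)) (n j) ∂P

/-- The radii `R i` are i.i.d. with distribution `ν`, and independent of the random environment
and of the points. -/
structure IsIndependentMarking {d : ℕ} {Ω : Type*} [MeasurableSpace Ω] (P : Measure Ω)
    (Λ : Ω → Measure (Space d)) (N : Ω → ℕ∞) (X : ℕ → Ω → Space d)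
    (ν : Measure ℝ≥0) (R : ℕ → Ω → ℝ≥0) : Prop where
  measurable : ∀ i, Measurable (R i)
  law : ∀ i, P.map (R i) = ν
  iindep : iIndepFun R P
  indep : IndepFun (fun ω (i : ℕ) => R i ω) (fun ω => (Λ ω, N ω, fun (i : ℕ) => X i ω)) P

/-- The Boolean model: the union of the open balls with centers `x i` and radii `r i`, `i < k`. -/
def booleanModel {d : ℕ} (k : ℕ∞) (x : ℕ → Space d) (r : ℕ → ℝ≥0) : Set (Space d) :=
  ⋃ (i : ℕ) (_ : (i : ℕ∞) < k), Metric.ball (x i) (r i)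

end CoxBoolean

namespace CoxBoolean

/-! The proof is a conditional second moment argument. Given `Λ`, the number of balls covering `x`
is Poisson, so `x` stays uncovered with conditional probability `p x = exp (-h x)`, where `h x` is
`lam` times the integral against `Λ` of the probability that a ball centred at `y` reaches `x`. By
stationarity and normalization the intensity measure `P.bind Λ` is a Haar measure, so the finite
`d`-th moment of the radii bounds the expectation of `h x` uniformly in `x`.

The moment also makes it unlikely that one ball covers two distant points, so the indicators `Z n`
that `x n` is uncovered are nearly uncorrelated given `Λ` when the `x n` are far apart. Hence the
averages of `Z n - p (x n)` are small in mean square. If full coverage had positive probability, all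
`Z n` would vanish there, and the averages of `p (x n)` would be small on that event; but Markov's
inequality for `h` bounds the integrals of `p (x n)` over it from below. So coverage has probability
zero, which gives both assertions.

The conditional law is extracted in `IsCoxProcess.measure_inter_avoidEvent` from the Laplace
functional, decorrelation is `measure_avoidEvent_inter_le`, and the contradiction comes from
`sq_le_of_second_moment`. -/

/-! ### The exponential on the extended half-line. -/

/-- The function `exp (-x)` on `[0, ∞]`. -/
noncomputable def expNeg (x : ℝ≥0∞) : ℝ≥0∞ := EReal.exp (-(x : EReal))

lemma expNeg_top : expNeg ∞ = 0 := by simp [expNeg]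

lemma expNeg_zero : expNeg 0 = 1 := by simp [expNeg]

lemma expNeg_of_ne_top {x : ℝ≥0∞} (hx : x ≠ ∞) :
    expNeg x = ENNReal.ofReal (Real.exp (-x.toReal)) := by
  lift x to ℝ≥0 using hx
  have : -((x : ℝ≥0∞) : EReal) = ((-(x : ℝ) : ℝ) : EReal) := rfl
  rw [expNeg, this, EReal.exp_coe]
  rfl

lemma expNeg_antitone : Antitone expNeg := fun x y h =>
  EReal.exp_monotone (EReal.neg_le_neg_iff.2 (by exact_mod_cast h))

lemma expNeg_le_one (x : ℝ≥0∞) : expNeg x ≤ 1 := expNeg_zero ▸ expNeg_antitone zero_le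

lemma expNeg_ne_top (x : ℝ≥0∞) : expNeg x ≠ ∞ :=
  ((expNeg_le_one x).trans_lt ENNReal.one_lt_top).ne

lemma continuous_expNeg : Continuous expNeg :=
  ENNReal.continuous_exp.comp (continuous_neg.comp continuous_coe_ennreal_ereal)

lemma measurable_expNeg : Measurable expNeg := continuous_expNeg.measurable

lemma expNeg_add (x y : ℝ≥0∞) : expNeg (x + y) = expNeg x * expNeg y := by
  rcases eq_or_ne x ∞ with rfl | hx
  · simp [expNeg_top]
  rcases eq_or_ne y ∞ with rfl | hy
  · simp [expNeg_top]
  rw [expNeg_of_ne_top hx, expNeg_of_ne_top hy, expNeg_of_ne_top (ENNReal.add_ne_top.2 ⟨hx, hy⟩),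
    ENNReal.toReal_add hx hy, ← ENNReal.ofReal_mul (Real.exp_nonneg _), ← Real.exp_add]
  congr 2
  ring

lemma expNeg_sum {ι : Type*} (s : Finset ι) (f : ι → ℝ≥0∞) :
    expNeg (∑ i ∈ s, f i) = ∏ i ∈ s, expNeg (f i) := by
  classical
  induction s using Finset.induction_on with
  | empty => simp [expNeg_zero]
  | insert a s ha ih => rw [Finset.sum_insert ha, Finset.prod_insert ha, expNeg_add, ih]

lemma one_le_expNeg_add (x : ℝ≥0∞) : 1 ≤ expNeg x + x := by
  rcases eq_or_ne x ∞ with rfl | hx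
  · simp
  rw [expNeg_of_ne_top hx]
  nth_rewrite 2 [← ENNReal.ofReal_toReal hx]
  rw [← ENNReal.ofReal_add (Real.exp_nonneg _) ENNReal.toReal_nonneg, ← ENNReal.ofReal_one]
  exact ENNReal.ofReal_le_ofReal (by linarith [Real.add_one_le_exp (-x.toReal)])

/-- Multiply `1 ≤ exp (-y) + y` by `exp (-x) ≤ 1`. This additive form controls the correlation error
by a quantity whose expectation is computable. -/
lemma expNeg_le_expNeg_add_add (x y : ℝ≥0∞) : expNeg x ≤ expNeg (x + y) + y :=
  calc expNeg x = expNeg x * 1 := (mul_one _).symm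
    _ ≤ expNeg x * (expNeg y + y) := by gcongr; exact one_le_expNeg_add y
    _ = expNeg (x + y) + expNeg x * y := by rw [mul_add, expNeg_add]
    _ ≤ expNeg (x + y) + y := by
        gcongr
        exact (mul_le_mul_left (expNeg_le_one x) y).trans_eq (one_mul y)

lemma iInf_expNeg_of_monotone {f : ℕ → ℝ≥0∞} (hf : Monotone f) :
    ⨅ n, expNeg (f n) = expNeg (⨆ n, f n) :=
  tendsto_nhds_unique (tendsto_atTop_iInf (fun _ _ h => expNeg_antitone (hf h)))
    ((continuous_expNeg.tendsto _).comp (tendsto_atTop_iSup hf))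

/-! ### Poisson generating function and survival products. -/

/-- The probability generating function of the Poisson distribution. -/
lemma tsum_pow_mul_poissonProb (m : ℝ≥0∞) {c : ℝ≥0∞} (hc : c ≠ 0) (hc1 : c ≤ 1) :
    ∑' n : ℕ, (1 - c) ^ n * poissonProb m n = expNeg (c * m) := by
  rcases eq_or_ne m ∞ with rfl | hm
  -- With infinite mean all finite counts have probability zero, and `c * ∞ = ∞` because `c ≠ 0`.
  · simp [poissonProb, ENNReal.mul_top hc, expNeg_top]
  have hct : c ≠ ∞ := ne_top_of_le_ne_top ENNReal.one_ne_top hc1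
  lift c to ℝ≥0 using hct
  lift m to ℝ≥0 using hm
  have hc1' : (c : ℝ) ≤ 1 := by exact_mod_cast hc1
  have h0 : 0 ≤ 1 - (c : ℝ) := by linarith
  have h1 : (1 - (c : ℝ≥0∞)) = ENNReal.ofReal (1 - c) := by
    rw [ENNReal.ofReal_sub (1 : ℝ) c.coe_nonneg]; simp
  have hterm : ∀ n : ℕ, (1 - (c : ℝ≥0∞)) ^ n * poissonProb m n =
      ENNReal.ofReal (Real.exp (-m) * (((1 - c) * m) ^ n / n.factorial)) := by
    intro n
    rw [poissonProb, if_neg ENNReal.coe_ne_top, poissonMeasure_singleton, h1,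
      ← ENNReal.ofReal_pow h0, ← ENNReal.ofReal_mul (pow_nonneg h0 n), ENNReal.toNNReal_coe]
    congr 1
    rw [mul_pow]
    ring
  have hs : HasSum (fun n : ℕ => Real.exp (-m) * (((1 - c) * m : ℝ) ^ n / n.factorial))
      (Real.exp (-m) * Real.exp ((1 - c) * m)) := by
    refine HasSum.mul_left _ ?_
    rw [Real.exp_eq_exp_ℝ]
    exact NormedSpace.expSeries_div_hasSum_exp ((1 - c) * m : ℝ)
  simp_rw [hterm]
  rw [← ENNReal.ofReal_tsum_of_nonneg _ hs.summable, hs.tsum_eq, ← Real.exp_add,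
    expNeg_of_ne_top (ENNReal.mul_ne_top ENNReal.coe_ne_top ENNReal.coe_ne_top)]
  · congr 2
    simp
    ring
  · intro n
    have := m.2
    positivity

lemma tsum_prod_fin {k : ℕ} (f : Fin k → ℕ → ℝ≥0∞) :
    ∑' n : Fin k → ℕ, ∏ j, f j (n j) = ∏ j, ∑' i, f j i := by
  induction k with
  | zero => simp
  | succ k ih =>
    rw [← (Fin.consEquiv (fun _ => ℕ)).tsum_eq, ENNReal.tsum_prod']
    simp only [Fin.consEquiv, Equiv.coe_fn_mk, Fin.prod_univ_succ, Fin.cons_zero, Fin.cons_succ,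
      ENNReal.tsum_mul_left, ih, ENNReal.tsum_mul_right]

/-- The product of `1 - φ (x i)` over the points `x i`, `i < k`. -/
noncomputable def survivalProd {d : ℕ} (φ : Space d → ℝ≥0∞) (k : ℕ∞) (x : ℕ → Space d) : ℝ≥0∞ :=
  ⨅ m : ℕ, ∏ i ∈ Finset.range m, if (i : ℕ∞) < k then 1 - φ (x i) else 1

lemma antitone_prod_range {f : ℕ → ℝ≥0∞} (hf : ∀ i, f i ≤ 1) :
    Antitone fun m => ∏ i ∈ Finset.range m, f i :=
  antitone_nat_of_succ_le fun m => by
    rw [Finset.prod_range_succ]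
    exact (mul_le_mul_right (hf m) _).trans_eq (mul_one _)

lemma survival_factor_le_one (p : Prop) [Decidable p] (a : ℝ≥0∞) :
    (if p then 1 - a else 1) ≤ 1 := by
  split_ifs
  · exact tsub_le_self
  · exact le_rfl

lemma survivalProd_le_one {d : ℕ} (φ : Space d → ℝ≥0∞) (k : ℕ∞) (x : ℕ → Space d) :
    survivalProd φ k x ≤ 1 := (iInf_le _ 0).trans (by simp)

section StepFunction

variable {d l : ℕ} {A : Fin l → Set (Space d)} {c : Fin l → ℝ≥0∞} {φ : Space d → ℝ≥0∞}
  [∀ j y, Decidable (y ∈ A j)]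

/-- Encoding a step function through `1 - φ` as a product over `j` lets the points be regrouped by
cell simply by exchanging two finite products. -/
lemma prod_range_eq_prod_pow_card (hφ : ∀ y, 1 - φ y = ∏ j, if y ∈ A j then 1 - c j else 1)
    (k : ℕ∞) (x : ℕ → Space d) (m : ℕ) :
    (∏ i ∈ Finset.range m, if (i : ℕ∞) < k then 1 - φ (x i) else 1) =
      ∏ j, (1 - c j) ^ ((Finset.range m).filter fun i : ℕ => (i : ℕ∞) < k ∧ x i ∈ A j).card := by
  have h : ∀ i : ℕ, (if (i : ℕ∞) < k then 1 - φ (x i) else 1) =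
      ∏ j, if (i : ℕ∞) < k ∧ x i ∈ A j then 1 - c j else 1 := by
    intro i
    by_cases hi : (i : ℕ∞) < k <;> simp [hi, hφ]
  simp_rw [h]
  rw [Finset.prod_comm]
  refine Finset.prod_congr rfl fun j _ => ?_
  rw [← Finset.prod_filter, Finset.prod_const]

/-- Only finitely many indices fall in the cells, so the partial products are eventually constant.
-/
lemma survivalProd_eq_prod_pow (hφ : ∀ y, 1 - φ y = ∏ j, if y ∈ A j then 1 - c j else 1)
    {k : ℕ∞} {x : ℕ → Space d} {n : Fin l → ℕ} (hn : ∀ j, pointCount k x (A j) = n j) :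
    survivalProd φ k x = ∏ j, (1 - c j) ^ n j := by
  classical
  have hfin : ∀ j, {i : ℕ | (i : ℕ∞) < k ∧ x i ∈ A j}.Finite := fun j =>
    Set.finite_of_encard_eq_coe (hn j)
  choose b hb using fun j => (hfin j).bddAbove
  have hlim : ∀ᶠ m in Filter.atTop,
      (∏ i ∈ Finset.range m, if (i : ℕ∞) < k then 1 - φ (x i) else 1) =
        ∏ j, (1 - c j) ^ n j := by
    have hall : ∀ᶠ m in Filter.atTop, ∀ j, b j < m :=
      Filter.eventually_all.2 fun j => Filter.eventually_gt_atTop (b j)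
    filter_upwards [hall] with m hm
    rw [prod_range_eq_prod_pow_card hφ]
    refine Finset.prod_congr rfl fun j _ => ?_
    congr 1
    have hset : (((Finset.range m).filter fun i : ℕ => (i : ℕ∞) < k ∧ x i ∈ A j : Finset ℕ) : Set ℕ) =
        {i : ℕ | (i : ℕ∞) < k ∧ x i ∈ A j} := by
      ext i
      simp only [Finset.coe_filter, Finset.mem_range, Set.mem_ofPred_eq, and_iff_right_iff_imp]
      exact fun hi => (hb j hi).trans_lt (hm j)
    have := hn j
    rw [pointCount, ← hset, Set.encard_coe_eq_coe_finsetCard] at this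
    exact_mod_cast this
  exact tendsto_nhds_unique
    (tendsto_atTop_iInf (antitone_prod_range fun i => survival_factor_le_one _ _))
    (tendsto_const_nhds.congr' (hlim.mono fun _ h => h.symm))

/-- Each of infinitely many points in cell `j` contributes the factor `1 - c j < 1`. -/
lemma survivalProd_eq_zero (hφ : ∀ y, 1 - φ y = ∏ j, if y ∈ A j then 1 - c j else 1)
    {k : ℕ∞} {x : ℕ → Space d} {j : Fin l} (hc : c j ≠ 0) (hj : pointCount k x (A j) = ⊤) :
    survivalProd φ k x = 0 := by
  classical
  have hle : ∀ t : ℕ, survivalProd φ k x ≤ (1 - c j) ^ t := by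
    intro t
    obtain ⟨s, hs, hst⟩ := (Set.encard_eq_top_iff.1 hj).exists_subset_card_eq t
    obtain ⟨b, hb⟩ := s.bddAbove
    refine (iInf_le _ (b + 1)).trans ?_
    rw [prod_range_eq_prod_pow_card hφ, ← Finset.mul_prod_erase _ _ (Finset.mem_univ j)]
    refine (mul_le_of_le_one_right' (Finset.prod_le_one' fun i _ =>
      pow_le_one₀ zero_le tsub_le_self)).trans ?_
    refine pow_le_pow_right_of_le_one' tsub_le_self ?_
    rw [← hst]
    refine Finset.card_le_card fun i hi => ?_
    rw [Finset.mem_filter, Finset.mem_range]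
    exact ⟨Nat.lt_succ_of_le (hb hi), hs hi⟩
  have hlt : 1 - c j < 1 := ENNReal.sub_lt_self ENNReal.one_ne_top one_ne_zero hc
  exact le_antisymm (ge_of_tendsto' (ENNReal.tendsto_pow_atTop_nhds_zero_of_lt_one hlt) hle)
    zero_le

end StepFunction

/-! ### Measurability of counts and survival products. -/

section Measurability

variable {d : ℕ} {Ω : Type*} [MeasurableSpace Ω] {N : Ω → ℕ∞} {X : ℕ → Ω → Space d}

lemma measurableSet_lt_number (hN : Measurable N) (i : ℕ) :
    MeasurableSet {ω | (i : ℕ∞) < N ω} :=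
  hN (MeasurableSet.of_discrete (s := Set.Ioi (i : ℕ∞)))

/-- A count is at least `t` exactly when some `t`-element set of indices is admissible, a countable
union of measurable events. -/
lemma measurableSet_pointCount_eq (hN : Measurable N) (hX : ∀ i, Measurable (X i))
    {A : Set (Space d)} (hA : MeasurableSet A) (n : ℕ) :
    MeasurableSet {ω | pointCount (N ω) (fun i => X i ω) A = n} := by
  have hle : ∀ t : ℕ, MeasurableSet {ω | (t : ℕ∞) ≤ pointCount (N ω) (fun i => X i ω) A} := by
    intro t
    have : {ω | (t : ℕ∞) ≤ pointCount (N ω) (fun i => X i ω) A} =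
        ⋃ s ∈ {s : Finset ℕ | s.card = t}, ⋂ i ∈ s, {ω | (i : ℕ∞) < N ω} ∩ X i ⁻¹' A := by
      ext ω
      simp only [Set.mem_ofPred_eq, Set.mem_iUnion, Set.mem_iInter, exists_prop, pointCount]
      constructor
      · intro h
        obtain ⟨u, hu, hut⟩ := Set.exists_subset_encard_eq h
        have huf := Set.finite_of_encard_eq_coe hut
        refine ⟨huf.toFinset, ?_, fun i hi => hu (huf.mem_toFinset.1 hi)⟩
        rw [huf.encard_eq_coe_toFinset_card] at hut
        exact_mod_cast hut
      · rintro ⟨s, hs, hsub⟩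
        rw [← hs, ← Set.encard_coe_eq_coe_finsetCard]
        exact Set.encard_le_encard fun i hi => hsub i hi
    rw [this]
    exact MeasurableSet.biUnion (Set.to_countable _) fun s _ =>
      s.measurableSet_biInter fun i _ => (measurableSet_lt_number hN i).inter (hX i hA)
  have : {ω | pointCount (N ω) (fun i => X i ω) A = n} =
      {ω | (n : ℕ∞) ≤ pointCount (N ω) (fun i => X i ω) A} \
        {ω | ((n + 1 : ℕ) : ℕ∞) ≤ pointCount (N ω) (fun i => X i ω) A} := by
    ext ω
    simp only [Set.mem_ofPred_eq, Set.mem_sdiff, not_le]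
    generalize pointCount (N ω) (fun i => X i ω) A = p
    induction p using ENat.recTopCoe with
    | top => simp
    | coe p => norm_cast; omega
  rw [this]
  exact (hle n).diff (hle (n + 1))

lemma measurable_prod_survival (hN : Measurable N) (hX : ∀ i, Measurable (X i))
    {φ : Space d → ℝ≥0∞} (hφ : Measurable φ) (m : ℕ) :
    Measurable fun ω => ∏ i ∈ Finset.range m,
      if (i : ℕ∞) < N ω then 1 - φ (X i ω) else 1 :=
  Finset.measurable_fun_prod _ fun i _ => Measurable.ite (measurableSet_lt_number hN i)
    (measurable_const.sub (hφ.comp (hX i))) measurable_const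

lemma measurable_survivalProd (hN : Measurable N) (hX : ∀ i, Measurable (X i))
    {φ : Space d → ℝ≥0∞} (hφ : Measurable φ) :
    Measurable fun ω => survivalProd φ (N ω) fun i => X i ω :=
  Measurable.iInf fun m => measurable_prod_survival hN hX hφ m

end Measurability

lemma measurable_poissonProb (n : ℕ) : Measurable fun m => poissonProb m n := by
  have h : (fun m => poissonProb m n) = fun m : ℝ≥0∞ => if m = ∞ then 0 else
      ENNReal.ofReal (Real.exp (-m.toReal) * m.toReal ^ n / n.factorial) := by
    ext m
    rw [poissonProb]
    split_ifs
    · rfl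
    · rw [poissonMeasure_singleton]; rfl
  rw [h]
  exact Measurable.ite (measurableSet_singleton _) measurable_const (by fun_prop)

/-! ### The Laplace functional: step, simple, then measurable functions. -/

section Laplace

variable {d : ℕ} {Ω : Type*} [MeasurableSpace Ω] {P : Measure Ω}
  {Λ : Ω → Measure (Space d)} {lam : ℝ≥0} {N : Ω → ℕ∞} {X : ℕ → Ω → Space d}

lemma measurable_expNeg_lintegral (hΛ : Measurable Λ) {φ : Space d → ℝ≥0∞} (hφ : Measurable φ) :
    Measurable fun ω => expNeg (lam * ∫⁻ y, φ y ∂(Λ ω)) :=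
  measurable_expNeg.comp
    (measurable_const.mul ((Measure.measurable_lintegral hφ).comp hΛ))

/-- The Laplace functional of a Cox process, for step functions. -/
lemma IsCoxProcess.setLIntegral_survivalProd_step (hX : IsCoxProcess P Λ lam N X)
    (hΛ : Measurable Λ) {l : ℕ} {A : Fin l → Set (Space d)} {c : Fin l → ℝ≥0∞}
    {φ : Space d → ℝ≥0∞} [∀ j y, Decidable (y ∈ A j)] (hA : ∀ j, MeasurableSet (A j))
    (hAd : Pairwise fun i j => Disjoint (A i) (A j)) (hc : ∀ j, c j ≠ 0) (hc1 : ∀ j, c j ≤ 1)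
    (hφ : ∀ y, 1 - φ y = ∏ j, if y ∈ A j then 1 - c j else 1)
    {D : Set (Measure (Space d))} (hD : MeasurableSet D) :
    ∫⁻ ω in Λ ⁻¹' D, survivalProd φ (N ω) (fun i => X i ω) ∂P =
      ∫⁻ ω in Λ ⁻¹' D, expNeg (lam * ∑ j, c j * Λ ω (A j)) ∂P := by
  set S : (Fin l → ℕ) → Set Ω :=
    fun n => {ω | ∀ j, pointCount (N ω) (fun i => X i ω) (A j) = n j} with hS
  have hSm : ∀ n, MeasurableSet (S n) := fun n => by
    have : S n = ⋂ j, {ω | pointCount (N ω) (fun i => X i ω) (A j) = n j} := by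
      ext; simp [hS]
    rw [this]
    exact MeasurableSet.iInter fun j =>
      measurableSet_pointCount_eq hX.measurable_number hX.measurable_point (hA j) (n j)
  -- Infinite counts need no term in the sum: the survival product is then zero.
  have hsum : ∀ ω, survivalProd φ (N ω) (fun i => X i ω) =
      ∑' n, (S n).indicator (fun _ => ∏ j, (1 - c j) ^ n j) ω := by
    intro ω
    by_cases hω : ∃ j, pointCount (N ω) (fun i => X i ω) (A j) = ⊤
    · obtain ⟨j, hj⟩ := hω
      rw [survivalProd_eq_zero hφ (hc j) hj, eq_comm, ENNReal.tsum_eq_zero]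
      intro n
      refine Set.indicator_of_notMem (fun h => ?_) _
      exact ENat.natCast_ne_top (n j) ((h j).symm.trans hj)
    · push Not at hω
      choose n hn using fun j => ENat.ne_top_iff_exists.1 (hω j)
      have hn' : ω ∈ S n := fun j => (hn j).symm
      rw [survivalProd_eq_prod_pow hφ hn', tsum_eq_single n, Set.indicator_of_mem hn']
      intro n' hne
      refine Set.indicator_of_notMem (fun h => hne ?_) _
      funext j
      exact_mod_cast (h j).symm.trans (hn' j)
  have hprob : ∀ n, ∫⁻ ω in Λ ⁻¹' D, (S n).indicator (fun _ => ∏ j, (1 - c j) ^ n j) ω ∂P =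
      ∫⁻ ω in Λ ⁻¹' D, ∏ j, (1 - c j) ^ n j * poissonProb (lam * Λ ω (A j)) (n j) ∂P := by
    intro n
    have hm : Measurable fun ω => ∏ j, poissonProb (lam * Λ ω (A j)) (n j) :=
      Finset.measurable_fun_prod _ fun j _ => (measurable_poissonProb (n j)).comp
        (measurable_const.mul ((Measure.measurable_coe (hA j)).comp hΛ))
    simp_rw [Finset.prod_mul_distrib]
    rw [lintegral_indicator_const (hSm n), Measure.restrict_apply (hSm n), lintegral_const_mul _ hm,
      ← hX.conditional_law l A hA hAd n D hD]
    congr 2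
    ext ω
    simp [hS, and_comm]
  simp_rw [hsum]
  rw [lintegral_tsum fun n => (measurable_const.indicator (hSm n)).aemeasurable]
  simp_rw [hprob]
  have hterm : ∀ n : Fin l → ℕ, Measurable fun ω =>
      ∏ j, (1 - c j) ^ n j * poissonProb (lam * Λ ω (A j)) (n j) := fun n =>
    Finset.measurable_fun_prod _ fun j _ => measurable_const.mul ((measurable_poissonProb (n j)).comp
      (measurable_const.mul ((Measure.measurable_coe (hA j)).comp hΛ)))
  rw [← lintegral_tsum fun n => (hterm n).aemeasurable]
  refine lintegral_congr fun ω => ?_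
  rw [tsum_prod_fin fun j i => (1 - c j) ^ i * poissonProb (lam * Λ ω (A j)) i, Finset.mul_sum,
    expNeg_sum]
  refine Finset.prod_congr rfl fun j _ => ?_
  rw [tsum_pow_mul_poissonProb _ (hc j) (hc1 j)]
  congr 1
  ring

/-- The Laplace functional of a Cox process, for simple functions. -/
lemma IsCoxProcess.setLIntegral_survivalProd_simpleFunc (hX : IsCoxProcess P Λ lam N X)
    (hΛ : Measurable Λ) (f : SimpleFunc (Space d) ℝ≥0∞) (hf : ∀ y, f y ≤ 1)
    {D : Set (Measure (Space d))} (hD : MeasurableSet D) :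
    ∫⁻ ω in Λ ⁻¹' D, survivalProd f (N ω) (fun i => X i ω) ∂P =
      ∫⁻ ω in Λ ⁻¹' D, expNeg (lam * ∫⁻ y, f y ∂(Λ ω)) ∂P := by
  classical
  -- The value zero is dropped: its fibre may hold infinitely many points, but these contribute only
  -- factors one.
  set J := f.range.filter (· ≠ 0) with hJ
  set e := J.equivFin
  set c : Fin J.card → ℝ≥0∞ := fun j => (e.symm j : ℝ≥0∞) with hcdef
  have hcJ : ∀ j, c j ∈ J := fun j => (e.symm j).2
  have hinj : Function.Injective c := Subtype.val_injective.comp e.symm.injective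
  have hc0 : ∀ j, c j ≠ 0 := fun j => (Finset.mem_filter.1 (hcJ j)).2
  have hc1 : ∀ j, c j ≤ 1 := fun j => by
    obtain ⟨y, hy⟩ := SimpleFunc.mem_range.1 (Finset.mem_filter.1 (hcJ j)).1
    exact hy ▸ hf y
  have hφ : ∀ y, 1 - f y = ∏ j, if y ∈ f ⁻¹' {c j} then 1 - c j else 1 := by
    intro y
    by_cases hy : f y = 0
    · rw [hy, tsub_zero, eq_comm]
      refine Finset.prod_eq_one fun j _ => if_neg fun h => hc0 j ?_
      exact (Set.mem_singleton_iff.1 h).symm.trans hy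
    · have hyJ : f y ∈ J := Finset.mem_filter.2 ⟨f.mem_range_self y, hy⟩
      have hcy : c (e ⟨f y, hyJ⟩) = f y := by simp [hcdef]
      rw [Finset.prod_eq_single (e ⟨f y, hyJ⟩)]
      · simp [hcy]
      · intro j _ hj
        refine if_neg fun h => hj (hinj ?_)
        exact (Set.mem_singleton_iff.1 h).symm.trans hcy.symm
      · simp
  rw [hX.setLIntegral_survivalProd_step hΛ (fun j => f.measurableSet_fiber (c j))
    (fun i j hij => Set.disjoint_left.2 fun y hi hj => hij (hinj (hi.symm.trans hj))) hc0 hc1 hφ hD]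
  refine lintegral_congr fun ω => ?_
  rw [SimpleFunc.lintegral_eq_lintegral, SimpleFunc.lintegral]
  congr 2
  have : ∑ x ∈ f.range, x * Λ ω (f ⁻¹' {x}) = ∑ x ∈ J, x * Λ ω (f ⁻¹' {x}) := by
    rw [hJ, Finset.sum_filter]
    refine Finset.sum_congr rfl fun x _ => ?_
    split_ifs with h
    · rfl
    · simp [not_not.1 h]
  rw [this, ← Finset.sum_coe_sort J, ← e.symm.sum_comp]

/-- The Laplace functional of a Cox process. -/
lemma IsCoxProcess.setLIntegral_survivalProd [IsProbabilityMeasure P]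
    (hX : IsCoxProcess P Λ lam N X)
    (hΛ : Measurable Λ) {φ : Space d → ℝ≥0∞} (hφ : Measurable φ) (hφ1 : ∀ y, φ y ≤ 1)
    {D : Set (Measure (Space d))} (hD : MeasurableSet D) :
    ∫⁻ ω in Λ ⁻¹' D, survivalProd φ (N ω) (fun i => X i ω) ∂P =
      ∫⁻ ω in Λ ⁻¹' D, expNeg (lam * ∫⁻ y, φ y ∂(Λ ω)) ∂P := by
  -- Both sides decrease along this increasing approximation and are bounded by one, so infima pass
  -- through the integrals.
  set f := SimpleFunc.eapprox φ with hf
  have hmono : ∀ y, Monotone fun n => f n y := fun y m n h => SimpleFunc.monotone_eapprox φ h y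
  have hsup : ∀ y, ⨆ n, f n y = φ y := fun y => SimpleFunc.iSup_eapprox_apply hφ y
  have hf1 : ∀ n y, f n y ≤ 1 := fun n y =>
    ((le_iSup (fun n => f n y) n).trans_eq (hsup y)).trans (hφ1 y)
  have hanti : ∀ (k : ℕ∞) (x : ℕ → Space d) (m : ℕ), Antitone fun n =>
      ∏ i ∈ Finset.range m, if (i : ℕ∞) < k then 1 - f n (x i) else 1 := by
    intro k x m n n' h
    refine Finset.prod_le_prod' fun i _ => ?_
    split_ifs
    · exact tsub_le_tsub_left (hmono (x i) h) 1
    · exact le_rfl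
  have hleft : ∀ ω, survivalProd φ (N ω) (fun i => X i ω) =
      ⨅ n, survivalProd (f n) (N ω) fun i => X i ω := by
    intro ω
    unfold survivalProd
    rw [iInf_comm]
    refine iInf_congr fun m => ?_
    refine tendsto_nhds_unique ?_ (tendsto_atTop_iInf (hanti _ _ m))
    refine ENNReal.tendsto_finsetProd_of_ne_top _ (fun i _ => ?_) fun i _ =>
      ((survival_factor_le_one _ _).trans_lt ENNReal.one_lt_top).ne
    split_ifs
    · refine ENNReal.Tendsto.sub tendsto_const_nhds ?_ (Or.inl ENNReal.one_ne_top)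
      rw [← hsup]
      exact tendsto_atTop_iSup (hmono _)
    · exact tendsto_const_nhds
  have hright : ∀ ω, expNeg (lam * ∫⁻ y, φ y ∂(Λ ω)) =
      ⨅ n, expNeg (lam * ∫⁻ y, f n y ∂(Λ ω)) := by
    intro ω
    rw [iInf_expNeg_of_monotone, ← ENNReal.mul_iSup,
      ← lintegral_iSup (fun n => (f n).measurable) fun m n h y => hmono y h]
    · simp_rw [hsup]
    · exact fun m n h => mul_le_mul_right (lintegral_mono fun y => hmono y h) _
  have hfin : ∀ g : Ω → ℝ≥0∞, (∀ ω, g ω ≤ 1) → ∫⁻ ω in Λ ⁻¹' D, g ω ∂P ≠ ∞ := fun g hg =>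
    ((lintegral_mono hg).trans_lt (by simp)).ne
  simp_rw [hleft, hright]
  rw [lintegral_iInf (fun n => measurable_survivalProd hX.measurable_number hX.measurable_point
      (f n).measurable) _ (hfin _ fun ω => survivalProd_le_one _ _ _),
    lintegral_iInf (fun n => measurable_expNeg_lintegral hΛ (f n).measurable) _
      (hfin _ fun ω => expNeg_le_one _)]
  · exact iInf_congr fun n => hX.setLIntegral_survivalProd_simpleFunc hΛ (f n) (hf1 n) hD
  · exact fun m n h ω => expNeg_antitone (mul_le_mul_right (lintegral_mono fun y => hmono y h) _)
  · exact fun m n h ω => iInf_mono fun t => hanti _ _ t h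

end Laplace

/-! ### Void probabilities of the marked process. -/

/-- The event that none of the marked points `(X i, R i)`, `i < N`, lies in `G`. -/
def avoidEvent {d : ℕ} {Ω : Type*} (N : Ω → ℕ∞) (X : ℕ → Ω → Space d) (R : ℕ → Ω → ℝ≥0)
    (G : Set (Space d × ℝ≥0)) : Set Ω :=
  {ω | ∀ i : ℕ, (i : ℕ∞) < N ω → (X i ω, R i ω) ∉ G}

lemma avoidEvent_eq_iInter {d : ℕ} {Ω : Type*} (N : Ω → ℕ∞) (X : ℕ → Ω → Space d) (R : ℕ → Ω → ℝ≥0)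
    (G : Set (Space d × ℝ≥0)) : avoidEvent N X R G =
      ⋂ m : ℕ, {ω | ∀ i : ℕ, i < m → (i : ℕ∞) < N ω → (X i ω, R i ω) ∉ G} := by
  ext ω
  simp only [avoidEvent, Set.mem_ofPred_eq, Set.mem_iInter]
  exact ⟨fun h _ i _ => h i, fun h i => h (i + 1) i (Nat.lt_succ_self i)⟩

section Marking

variable {d : ℕ} {Ω : Type*} [MeasurableSpace Ω] {P : Measure Ω}
  {Λ : Ω → Measure (Space d)} {lam : ℝ≥0} {N : Ω → ℕ∞} {X : ℕ → Ω → Space d}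
  {ν : Measure ℝ≥0} {R : ℕ → Ω → ℝ≥0}

lemma measurableSet_avoid_of_lt (hN : Measurable N) (hX : ∀ i, Measurable (X i))
    (hR : ∀ i, Measurable (R i)) {G : Set (Space d × ℝ≥0)} (hG : MeasurableSet G) (m : ℕ) :
    MeasurableSet {ω | ∀ i : ℕ, i < m → (i : ℕ∞) < N ω → (X i ω, R i ω) ∉ G} := by
  simp only [Set.ofPred_forall]
  refine MeasurableSet.iInter fun i => MeasurableSet.iInter fun _ => ?_
  have : {ω | (i : ℕ∞) < N ω → (X i ω, R i ω) ∉ G} =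
      {ω | (i : ℕ∞) < N ω}ᶜ ∪ (fun ω => (X i ω, R i ω)) ⁻¹' Gᶜ := by
    ext ω
    exact imp_iff_not_or
  rw [this]
  exact (measurableSet_lt_number hN i).compl.union (((hX i).prodMk (hR i)) hG.compl)

lemma measurableSet_avoidEvent (hN : Measurable N) (hX : ∀ i, Measurable (X i))
    (hR : ∀ i, Measurable (R i)) {G : Set (Space d × ℝ≥0)} (hG : MeasurableSet G) :
    MeasurableSet (avoidEvent N X R G) := by
  rw [avoidEvent_eq_iInter]
  exact MeasurableSet.iInter fun m => measurableSet_avoid_of_lt hN hX hR hG m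

lemma IsIndependentMarking.isProbabilityMeasure [IsProbabilityMeasure P]
    (hR : IsIndependentMarking P Λ N X ν R) : IsProbabilityMeasure ν :=
  hR.law 0 ▸ Measure.isProbabilityMeasure_map (hR.measurable 0).aemeasurable

lemma IsIndependentMarking.measure_avoid_fixed [IsProbabilityMeasure P]
    (hR : IsIndependentMarking P Λ N X ν R) {G : Set (Space d × ℝ≥0)} (hG : MeasurableSet G)
    (m : ℕ) (k : ℕ∞) (x : ℕ → Space d) :
    P {ω | ∀ i : ℕ, i < m → (i : ℕ∞) < k → (x i, R i ω) ∉ G} =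
      ∏ i ∈ Finset.range m, if (i : ℕ∞) < k then 1 - ν (Prod.mk (x i) ⁻¹' G) else 1 := by
  have := hR.isProbabilityMeasure
  set B : ℕ → Set ℝ≥0 := fun i => if (i : ℕ∞) < k then (Prod.mk (x i) ⁻¹' G)ᶜ else Set.univ with hB
  have hGx : ∀ i, MeasurableSet (Prod.mk (x i) ⁻¹' G) := fun i => measurable_prodMk_left hG
  have hBm : ∀ i, MeasurableSet (B i) := fun i => by
    simp only [hB]
    split_ifs
    · exact (hGx i).compl
    · exact MeasurableSet.univ
  have hset : {ω | ∀ i : ℕ, i < m → (i : ℕ∞) < k → (x i, R i ω) ∉ G} =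
      ⋂ i ∈ Finset.range m, R i ⁻¹' B i := by
    ext ω
    simp only [Set.mem_ofPred_eq, Set.mem_iInter, Finset.mem_range, hB, Set.mem_preimage]
    refine forall₂_congr fun i _ => ?_
    by_cases hi : (i : ℕ∞) < k <;> simp [hi]
  rw [hset, hR.iindep.measure_inter_preimage_eq_mul _ fun i _ => hBm i]
  refine Finset.prod_congr rfl fun i _ => ?_
  rw [← Measure.map_apply (hR.measurable i) (hBm i), hR.law i]
  simp only [hB]
  split_ifs
  · exact prob_compl_eq_one_sub (hGx i)
  · exact measure_univ

/-- The radii are independent of the environment and points jointly, so Fubini on the product law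
reduces to frozen positions. -/
lemma IsIndependentMarking.measure_inter_avoid_of_lt [IsProbabilityMeasure P]
    (hR : IsIndependentMarking P Λ N X ν R) (hΛ : Measurable Λ) (hN : Measurable N)
    (hX : ∀ i, Measurable (X i)) {G : Set (Space d × ℝ≥0)} (hG : MeasurableSet G)
    {D : Set (Measure (Space d))} (hD : MeasurableSet D) (m : ℕ) :
    P (Λ ⁻¹' D ∩ {ω | ∀ i : ℕ, i < m → (i : ℕ∞) < N ω → (X i ω, R i ω) ∉ G}) =
      ∫⁻ ω in Λ ⁻¹' D, ∏ i ∈ Finset.range m,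
        if (i : ℕ∞) < N ω then 1 - ν (Prod.mk (X i ω) ⁻¹' G) else 1 ∂P := by
  set W : Ω → Measure (Space d) × ℕ∞ × (ℕ → Space d) := fun ω => (Λ ω, N ω, fun i => X i ω) with hW
  set S : Ω → ℕ → ℝ≥0 := fun ω i => R i ω with hS
  have hWm : Measurable W := hΛ.prodMk (hN.prodMk (measurable_pi_iff.2 hX))
  have hSm : Measurable S := measurable_pi_iff.2 hR.measurable
  set T : Set ((ℕ → ℝ≥0) × (Measure (Space d) × ℕ∞ × (ℕ → Space d))) :=
    {p | p.2.1 ∈ D} ∩ {p | ∀ i : ℕ, i < m → (i : ℕ∞) < p.2.2.1 → (p.2.2.2 i, p.1 i) ∉ G} with hT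
  have hTm : MeasurableSet T := by
    refine (measurable_snd.fst hD).inter ?_
    exact measurableSet_avoid_of_lt (Ω := (ℕ → ℝ≥0) × (Measure (Space d) × ℕ∞ × (ℕ → Space d)))
      (N := fun p => p.2.2.1) (X := fun i p => p.2.2.2 i) (R := fun i p => p.1 i)
      measurable_snd.snd.fst (fun i => (measurable_pi_apply i).comp measurable_snd.snd.snd)
      (fun i => (measurable_pi_apply i).comp measurable_fst) hG m
  have hpre : Λ ⁻¹' D ∩ {ω | ∀ i : ℕ, i < m → (i : ℕ∞) < N ω → (X i ω, R i ω) ∉ G} =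
      (fun ω => (S ω, W ω)) ⁻¹' T := rfl
  rw [hpre, ← Measure.map_apply (hSm.prodMk hWm) hTm,
    (indepFun_iff_map_prod_eq_prod_map_map hSm.aemeasurable hWm.aemeasurable).1 hR.indep]
  have : IsProbabilityMeasure (P.map S) := Measure.isProbabilityMeasure_map hSm.aemeasurable
  have : IsProbabilityMeasure (P.map W) := Measure.isProbabilityMeasure_map hWm.aemeasurable
  rw [Measure.prod_apply_symm hTm, lintegral_map (measurable_measure_prodMk_right hTm) hWm,
    ← lintegral_indicator (hΛ hD)]
  refine lintegral_congr fun ω => ?_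
  rw [Measure.map_apply hSm (measurable_prodMk_right hTm)]
  by_cases hω : ω ∈ Λ ⁻¹' D
  · rw [Set.indicator_of_mem hω, ← hR.measure_avoid_fixed hG]
    congr 1
    ext ω'
    simp only [hT, hS, hW, Set.mem_preimage, Set.mem_inter_iff, Set.mem_ofPred_eq]
    exact and_iff_right hω
  · rw [Set.indicator_of_notMem hω]
    refine measure_mono_null (fun ω' h => ?_) measure_empty
    exact hω h.1

/-- The void probabilities of the marked process, given the random measure. -/
lemma IsCoxProcess.measure_inter_avoidEvent [IsProbabilityMeasure P]
    (hX : IsCoxProcess P Λ lam N X) (hΛ : Measurable Λ) (hR : IsIndependentMarking P Λ N X ν R)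
    {G : Set (Space d × ℝ≥0)} (hG : MeasurableSet G)
    {D : Set (Measure (Space d))} (hD : MeasurableSet D) :
    P (Λ ⁻¹' D ∩ avoidEvent N X R G) =
      ∫⁻ ω in Λ ⁻¹' D, expNeg (lam * ∫⁻ y, ν (Prod.mk y ⁻¹' G) ∂(Λ ω)) ∂P := by
  have := hR.isProbabilityMeasure
  have hφ : Measurable fun y => ν (Prod.mk y ⁻¹' G) := measurable_measure_prodMk_left hG
  rw [← hX.setLIntegral_survivalProd hΛ hφ (fun y => prob_le_one) hD]
  unfold survivalProd
  rw [lintegral_iInf (fun m => measurable_prod_survival hX.measurable_number hX.measurable_point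
      hφ m) (fun m n h ω => antitone_prod_range (fun i => survival_factor_le_one _ _) h) (by simp),
    avoidEvent_eq_iInter, Set.inter_iInter, Antitone.measure_iInter]
  · exact iInf_congr fun m => hR.measure_inter_avoid_of_lt hΛ hX.measurable_number
      hX.measurable_point hG hD m
  · exact fun m n h => Set.inter_subset_inter_right _ fun ω hω i hi => hω i (hi.trans_le h)
  · exact fun m => ((hΛ hD).inter (measurableSet_avoid_of_lt hX.measurable_number
      hX.measurable_point hR.measurable hG m)).nullMeasurableSet
  · exact ⟨0, measure_ne_top _ _⟩

/-- This identifies `expNeg` of the conditional mean as the conditional void probability given `Λ`,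
tested against functions of `Λ` rather than events. -/
lemma IsCoxProcess.setLIntegral_avoidEvent [IsProbabilityMeasure P]
    (hX : IsCoxProcess P Λ lam N X) (hΛ : Measurable Λ) (hR : IsIndependentMarking P Λ N X ν R)
    {G : Set (Space d × ℝ≥0)} (hG : MeasurableSet G)
    {g : Measure (Space d) → ℝ≥0∞} (hg : Measurable g) :
    ∫⁻ ω in avoidEvent N X R G, g (Λ ω) ∂P =
      ∫⁻ ω, expNeg (lam * ∫⁻ y, ν (Prod.mk y ⁻¹' G) ∂(Λ ω)) * g (Λ ω) ∂P := by
  have := hR.isProbabilityMeasure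
  have he : Measurable fun ω => expNeg (lam * ∫⁻ y, ν (Prod.mk y ⁻¹' G) ∂(Λ ω)) :=
    measurable_expNeg_lintegral hΛ (measurable_measure_prodMk_left hG)
  have hmap : (P.restrict (avoidEvent N X R G)).map Λ = (P.withDensity fun ω =>
      expNeg (lam * ∫⁻ y, ν (Prod.mk y ⁻¹' G) ∂(Λ ω))).map Λ := by
    ext D hD
    rw [Measure.map_apply hΛ hD, Measure.map_apply hΛ hD, Measure.restrict_apply (hΛ hD),
      withDensity_apply _ (hΛ hD), hX.measure_inter_avoidEvent hΛ hR hG hD]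
  rw [← lintegral_map hg hΛ, hmap, lintegral_map hg hΛ]
  exact lintegral_withDensity_eq_lintegral_mul _ he (hg.comp hΛ)

end Marking

/-! ### Covering marks and the intensity measure. -/

/-- The marked points `(y, r)` whose open ball `B_r(y)` contains `x`. -/
def coveringMarks {d : ℕ} (x : Space d) : Set (Space d × ℝ≥0) := {p | dist x p.1 < p.2}

lemma measurableSet_coveringMarks {d : ℕ} (x : Space d) : MeasurableSet (coveringMarks x) :=
  measurableSet_lt (by fun_prop) (by fun_prop)

section Intensity

variable {d : ℕ} {Ω : Type*} [MeasurableSpace Ω] {P : Measure Ω} {Λ : Ω → Measure (Space d)}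

/-- `P.bind Λ` is the intensity measure; evaluating it on a set uses only the law of `Λ`, which
translation preserves. -/
lemma isAddLeftInvariant_bind (hΛ : IsStationaryNormalized P Λ) :
    (P.bind Λ).IsAddLeftInvariant := by
  refine ⟨fun x => ?_⟩
  ext B hB
  have hadd : Measurable fun y : Space d => x + y := measurable_const_add x
  have htr : Measurable fun m : Measure (Space d) => translateMeasure x m :=
    Measure.measurable_map _ (measurable_add_const x)
  have heval : Measurable fun m : Measure (Space d) => m B := Measure.measurable_coe hB
  rw [Measure.map_apply hadd hB, Measure.bind_apply (hadd hB) hΛ.measurable.aemeasurable,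
    Measure.bind_apply hB hΛ.measurable.aemeasurable, ← lintegral_map heval hΛ.measurable,
    ← hΛ.stationary x, lintegral_map heval (htr.fun_comp hΛ.measurable)]
  refine lintegral_congr fun ω => ?_
  rw [translateMeasure, Measure.map_apply (measurable_add_const x) hB]
  simp_rw [add_comm x]

lemma isCompact_unitCube (d : ℕ) : IsCompact (unitCube d) := by
  have : unitCube d = (EuclideanSpace.equiv (Fin d) ℝ) ⁻¹' Set.univ.pi fun _ => Set.Icc 0 1 := by
    ext x
    simp only [unitCube, Set.mem_preimage, Set.mem_univ_pi]
    rfl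
  rw [this]
  exact (EuclideanSpace.equiv (Fin d) ℝ).toHomeomorph.isCompact_preimage.2
    (isCompact_univ_pi fun _ => isCompact_Icc)

lemma interior_unitCube_nonempty (d : ℕ) : (interior (unitCube d)).Nonempty := by
  have hopen : IsOpen {x : Space d | ∀ i, x i ∈ Set.Ioo (0 : ℝ) 1} := by
    simp only [Set.ofPred_forall]
    exact isOpen_iInter_of_finite fun i => isOpen_Ioo.preimage (EuclideanSpace.proj i).continuous
  have hsub : {x : Space d | ∀ i, x i ∈ Set.Ioo (0 : ℝ) 1} ⊆ unitCube d :=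
    fun x hx i => Set.Ioo_subset_Icc_self (hx i)
  refine ⟨WithLp.toLp 2 fun _ => 1 / 2, interior_maximal hsub hopen fun i => ?_⟩
  norm_num

/-- Mass one on a compact set with nonempty interior makes the invariant measure both nonzero and
locally finite. -/
lemma isAddHaarMeasure_bind (hΛ : IsStationaryNormalized P Λ) :
    (P.bind Λ).IsAddHaarMeasure := by
  have := isAddLeftInvariant_bind hΛ
  have h1 : (P.bind Λ) (unitCube d) = 1 := by
    rw [Measure.bind_apply (isCompact_unitCube d).measurableSet hΛ.measurable.aemeasurable,
      hΛ.normalized]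
  exact Measure.isAddHaarMeasure_of_isCompact_nonempty_interior _ (unitCube d)
    (isCompact_unitCube d) (interior_unitCube_nonempty d) (by simp [h1]) (by simp [h1])

end Intensity

/-! ### Mean numbers of covering balls. -/

section MeanMass

variable {d : ℕ} (μ : Measure (Space d)) [μ.IsAddHaarMeasure] (ν : Measure ℝ≥0) [SFinite ν]

lemma measure_ball_le (x : Space d) (r : ℝ≥0) :
    μ (Metric.ball x r) ≤ μ (Metric.ball 0 1) * (r : ℝ≥0∞) ^ d := by
  rcases eq_or_ne r 0 with rfl | hr
  · simp
  · rw [Measure.addHaar_ball_of_pos μ x (by exact_mod_cast pos_iff_ne_zero.2 hr),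
      finrank_euclideanSpace_fin, ENNReal.ofReal_pow r.coe_nonneg, ENNReal.ofReal_coe_nnreal,
      mul_comm]

lemma lintegral_measure_section {G : Set (Space d × ℝ≥0)} (hG : MeasurableSet G) :
    ∫⁻ y, ν (Prod.mk y ⁻¹' G) ∂μ = ∫⁻ r, μ ((fun y => (y, r)) ⁻¹' G) ∂ν := by
  rw [← Measure.prod_apply hG, Measure.prod_apply_symm hG]

lemma preimage_coveringMarks (x : Space d) (r : ℝ≥0) :
    (fun y => (y, r)) ⁻¹' coveringMarks x = Metric.ball x r := by
  ext y
  simp [coveringMarks, dist_comm]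

lemma lintegral_coveringMarks_le (x : Space d) :
    ∫⁻ y, ν (Prod.mk y ⁻¹' coveringMarks x) ∂μ ≤
      μ (Metric.ball 0 1) * ∫⁻ r, (r : ℝ≥0∞) ^ d ∂ν := by
  rw [lintegral_measure_section μ ν (measurableSet_coveringMarks x),
    ← lintegral_const_mul _ (by fun_prop)]
  refine lintegral_mono fun r => ?_
  rw [preimage_coveringMarks]
  exact measure_ball_le μ x r

/-- Points that are far apart are rarely covered by the same ball. -/
lemma exists_forall_lintegral_coveringMarks_inter_le
    (hν : ∫⁻ r, (r : ℝ≥0∞) ^ d ∂ν < ∞) {ε : ℝ≥0∞} (hε : 0 < ε) :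
    ∃ K : ℕ, ∀ x x' : Space d, (K : ℝ) ≤ dist x x' →
      ∫⁻ y, ν (Prod.mk y ⁻¹' (coveringMarks x ∩ coveringMarks x')) ∂μ ≤ ε := by
  -- Balls of radius `r` about points at distance at least `K` are disjoint once `2 * r ≤ K`, so
  -- only larger radii matter; dominated convergence kills this tail.
  set f : ℕ → ℝ≥0 → ℝ≥0∞ := fun K => {r : ℝ≥0 | (K : ℝ) < 2 * r}.indicator
    fun r => μ (Metric.ball 0 1) * (r : ℝ≥0∞) ^ d with hf
  have hm : ∀ K : ℕ, MeasurableSet {r : ℝ≥0 | (K : ℝ) < 2 * r} := fun K =>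
    measurableSet_lt (by fun_prop) (by fun_prop)
  have hlim : Filter.Tendsto (fun K => ∫⁻ r, f K r ∂ν) Filter.atTop (nhds (∫⁻ _, 0 ∂ν)) := by
    refine tendsto_lintegral_of_dominated_convergence
      (fun r => μ (Metric.ball 0 1) * (r : ℝ≥0∞) ^ d)
      (fun K => Measurable.indicator (by fun_prop) (hm K))
      (fun K => .of_forall fun r => Set.indicator_le_self _ _ r) ?_ (.of_forall fun r => ?_)
    · rw [lintegral_const_mul _ (by fun_prop)]
      exact ENNReal.mul_ne_top measure_ball_lt_top.ne hν.ne
    · refine tendsto_const_nhds.congr' ?_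
      obtain ⟨K₀, hK₀⟩ := exists_nat_ge (2 * r : ℝ)
      filter_upwards [Filter.eventually_ge_atTop K₀] with K hK
      refine (Set.indicator_of_notMem (fun h => ?_) _).symm
      have : (K₀ : ℝ) ≤ K := by exact_mod_cast hK
      have h' : (K : ℝ) < 2 * r := h
      linarith
  rw [lintegral_zero] at hlim
  obtain ⟨K, hK⟩ := (hlim.eventually_le_const hε).exists
  refine ⟨K, fun x x' hxx' => le_trans ?_ hK⟩
  rw [lintegral_measure_section μ ν
    ((measurableSet_coveringMarks x).inter (measurableSet_coveringMarks x'))]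
  refine lintegral_mono fun r => ?_
  by_cases hr : (K : ℝ) < 2 * r
  · simp only [hf]
    rw [Set.indicator_of_mem (show r ∈ {r : ℝ≥0 | (K : ℝ) < 2 * r} from hr),
      Set.preimage_inter, preimage_coveringMarks]
    exact (measure_mono Set.inter_subset_left).trans (measure_ball_le μ x r)
  · have : (fun y => (y, r)) ⁻¹' (coveringMarks x ∩ coveringMarks x') = ∅ := by
      rw [Set.preimage_inter, preimage_coveringMarks, preimage_coveringMarks]
      refine (Metric.ball_disjoint_ball ?_).inter_eq
      linarith
    simp [this]

end MeanMass

/-! ### Decorrelation and the second moment bound. -/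

/-- Inclusion-exclusion: adding the mass of `G ∩ G'` to that of `G ∪ G'` makes the exponential
factor. -/
lemma expNeg_union_le {d : ℕ} (m : Measure (Space d)) (ν : Measure ℝ≥0) [SFinite ν] (lam : ℝ≥0)
    {G G' : Set (Space d × ℝ≥0)} (hG : MeasurableSet G) (hG' : MeasurableSet G') :
    expNeg (lam * ∫⁻ y, ν (Prod.mk y ⁻¹' (G ∪ G')) ∂m) ≤
      expNeg (lam * ∫⁻ y, ν (Prod.mk y ⁻¹' G) ∂m) * expNeg (lam * ∫⁻ y, ν (Prod.mk y ⁻¹' G') ∂m) +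
        lam * ∫⁻ y, ν (Prod.mk y ⁻¹' (G ∩ G')) ∂m := by
  refine (expNeg_le_expNeg_add_add _ (lam * ∫⁻ y, ν (Prod.mk y ⁻¹' (G ∩ G')) ∂m)).trans_eq ?_
  rw [← expNeg_add, ← mul_add, ← mul_add,
    ← lintegral_add_left (measurable_measure_prodMk_left (hG.union hG')),
    ← lintegral_add_left (measurable_measure_prodMk_left hG)]
  congr 4
  funext y
  exact measure_union_add_inter _ (measurable_prodMk_left hG')

/-- A second moment bound: if the `Z n` vanish on `A`, while the sum of the `Z n - p n` is small in
mean square, then the `p n` are small on `A`. -/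
lemma sq_le_of_second_moment {Ω : Type*} [MeasurableSpace Ω] {P : Measure Ω}
    [IsProbabilityMeasure P] {Z p : ℕ → Ω → ℝ} (hZ : ∀ n, Measurable (Z n))
    (hp : ∀ n, Measurable (p n)) (hZ01 : ∀ n ω, Z n ω ∈ Set.Icc (0 : ℝ) 1)
    (hp01 : ∀ n ω, p n ω ∈ Set.Icc (0 : ℝ) 1) {A : Set Ω} (hA : MeasurableSet A)
    (hZA : ∀ n, ∀ ω ∈ A, Z n ω = 0) {ε δ : ℝ} (hε : 0 ≤ ε) (hδ : 0 ≤ δ)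
    (hZZ : ∀ n m, n ≠ m → ∫ ω, Z n ω * Z m ω ∂P ≤ ∫ ω, p n ω * p m ω ∂P + ε)
    (hZp : ∀ n m, ∫ ω, Z n ω * p m ω ∂P = ∫ ω, p n ω * p m ω ∂P)
    (hpA : ∀ n, δ ≤ ∫ ω in A, p n ω ∂P) : δ ^ 2 ≤ ε := by
  have hint : ∀ f g : Ω → ℝ, Measurable f → Measurable g → (∀ ω, f ω ∈ Set.Icc (0 : ℝ) 1) →
      (∀ ω, g ω ∈ Set.Icc (0 : ℝ) 1) → Integrable (fun ω => f ω * g ω) P := by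
    intro f g hf hg hf1 hg1
    refine Integrable.of_bound (hf.mul hg).aestronglyMeasurable 1 (.of_forall fun ω => ?_)
    rw [Real.norm_of_nonneg (mul_nonneg (hf1 ω).1 (hg1 ω).1)]
    exact mul_le_one₀ (hf1 ω).2 (hg1 ω).1 (hg1 ω).2
  have hpint : ∀ n, Integrable (p n) P := fun n => by
    refine Integrable.of_bound (hp n).aestronglyMeasurable 1 (.of_forall fun ω => ?_)
    rw [Real.norm_of_nonneg (hp01 n ω).1]
    exact (hp01 n ω).2
  have hexp : ∀ n m ω, (Z n ω - p n ω) * (Z m ω - p m ω) =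
      Z n ω * Z m ω - Z n ω * p m ω - (Z m ω * p n ω - p n ω * p m ω) := fun n m ω => by ring
  have i1 := fun n m => hint _ _ (hZ n) (hZ m) (hZ01 n) (hZ01 m)
  have i2 := fun n m => hint _ _ (hZ n) (hp m) (hZ01 n) (hp01 m)
  have i3 := fun n m => hint _ _ (hp n) (hp m) (hp01 n) (hp01 m)
  have j1 : ∀ n m, Integrable (fun ω => Z n ω * Z m ω - Z n ω * p m ω) P := fun n m =>
    (i1 n m).sub (i2 n m)
  have j2 : ∀ n m, Integrable (fun ω => Z m ω * p n ω - p n ω * p m ω) P := fun n m =>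
    (i2 m n).sub (i3 n m)
  have hprodint : ∀ n m, Integrable (fun ω => (Z n ω - p n ω) * (Z m ω - p m ω)) P := by
    intro n m
    simp_rw [hexp]
    exact (j1 n m).sub (j2 n m)
  have hcov : ∀ n m, ∫ ω, (Z n ω - p n ω) * (Z m ω - p m ω) ∂P ≤ ε + if n = m then 1 else 0 := by
    intro n m
    have heq : ∫ ω, (Z n ω - p n ω) * (Z m ω - p m ω) ∂P =
        ∫ ω, Z n ω * Z m ω ∂P - ∫ ω, p n ω * p m ω ∂P := by
      simp_rw [hexp]
      rw [integral_sub (j1 n m) (j2 n m), integral_sub (i1 n m) (i2 n m),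
        integral_sub (i2 m n) (i3 n m), hZp n m, hZp m n]
      simp_rw [mul_comm (p m _) (p n _)]
      ring
    rw [heq]
    split_ifs with h
    · have h1 : ∫ ω, Z n ω * Z m ω ∂P ≤ 1 := by
        have := integral_mono (i1 n m) (integrable_const (1 : ℝ)) fun ω =>
          mul_le_one₀ (hZ01 n ω).2 (hZ01 m ω).1 (hZ01 m ω).2
        simpa using this
      have h2 : 0 ≤ ∫ ω, p n ω * p m ω ∂P :=
        integral_nonneg fun ω => mul_nonneg (hp01 n ω).1 (hp01 m ω).1
      linarith
    · linarith [hZZ n m h]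
  have hmain : ∀ L : ℕ, (L * δ) ^ 2 ≤ L ^ 2 * ε + L := by
    intro L
    have hsq : ∀ ω, (∑ n ∈ Finset.range L, (Z n ω - p n ω)) ^ 2 =
        ∑ n ∈ Finset.range L, ∑ m ∈ Finset.range L, (Z n ω - p n ω) * (Z m ω - p m ω) := by
      intro ω
      rw [sq, Finset.sum_mul_sum]
    have hsqint : Integrable (fun ω => (∑ n ∈ Finset.range L, (Z n ω - p n ω)) ^ 2) P := by
      simp_rw [hsq]
      exact integrable_finsetSum _ fun n _ => integrable_finsetSum _ fun m _ => hprodint n m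
    have hup : ∫ ω, (∑ n ∈ Finset.range L, (Z n ω - p n ω)) ^ 2 ∂P ≤ L ^ 2 * ε + L := by
      simp_rw [hsq]
      rw [integral_finsetSum _ fun n _ => integrable_finsetSum _ fun m _ => hprodint n m]
      simp_rw [integral_finsetSum _ fun m _ => hprodint _ m]
      calc _ ≤ ∑ n ∈ Finset.range L, ∑ m ∈ Finset.range L, (ε + if n = m then 1 else 0) :=
            Finset.sum_le_sum fun n _ => Finset.sum_le_sum fun m _ => hcov n m
        _ = ∑ n ∈ Finset.range L, (L * ε + 1) := by
            refine Finset.sum_congr rfl fun n hn => ?_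
            rw [Finset.sum_add_distrib, Finset.sum_ite_eq, if_pos hn]
            simp
        _ = L ^ 2 * ε + L := by simp; ring
    have hsint : Integrable (A.indicator fun ω => ∑ n ∈ Finset.range L, p n ω) P :=
      (integrable_finsetSum _ fun n _ => hpint n).indicator hA
    -- On `A` this is `s ^ 2 ≥ 2 * (L * δ) * s - (L * δ) ^ 2` with `s` the sum of the `p n`;
    -- linearizing the square replaces Cauchy-Schwarz.
    have hlow : ∫ ω, (2 * (L * δ) * A.indicator (fun ω => ∑ n ∈ Finset.range L, p n ω) ω
        - (L * δ) ^ 2) ∂P ≤ ∫ ω, (∑ n ∈ Finset.range L, (Z n ω - p n ω)) ^ 2 ∂P := by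
      refine integral_mono ((hsint.const_mul _).sub (integrable_const _)) hsqint fun ω => ?_
      by_cases hω : ω ∈ A
      · have h : ∑ n ∈ Finset.range L, (Z n ω - p n ω) = -∑ n ∈ Finset.range L, p n ω := by
          rw [← Finset.sum_neg_distrib]
          exact Finset.sum_congr rfl fun n _ => by rw [hZA n ω hω, zero_sub]
        simp only [Set.indicator_of_mem hω, h]
        nlinarith [sq_nonneg (∑ n ∈ Finset.range L, p n ω - L * δ)]
      · simp only [Set.indicator_of_notMem hω]
        nlinarith [sq_nonneg (L * δ), sq_nonneg (∑ n ∈ Finset.range L, (Z n ω - p n ω))]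
    rw [integral_sub (hsint.const_mul _) (integrable_const _), integral_const_mul,
      integral_indicator hA, integral_finsetSum _ fun n _ => (hpint n).integrableOn] at hlow
    have hs : L * δ ≤ ∑ n ∈ Finset.range L, ∫ ω in A, p n ω ∂P := by
      have := Finset.card_nsmul_le_sum (Finset.range L) (fun n => ∫ ω in A, p n ω ∂P) δ
        fun n _ => hpA n
      simpa using this
    have hLδ : 0 ≤ L * δ := by positivity
    simp only [integral_const, probReal_univ, one_smul] at hlow
    nlinarith [mul_le_mul_of_nonneg_left hs hLδ]
  -- The diagonal contributes only `L` against `L ^ 2`, so it is negligible for large `L`.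
  by_contra! hlt
  obtain ⟨L, hL⟩ := exists_nat_gt (1 / (δ ^ 2 - ε))
  have hpos : 0 < δ ^ 2 - ε := by linarith
  have hL0 : (0 : ℝ) < L := (by positivity : 0 < 1 / (δ ^ 2 - ε)).trans hL
  rw [div_lt_iff₀ hpos] at hL
  have := mul_lt_mul_of_pos_left hL hL0
  nlinarith [hmain L]

lemma notMem_booleanModel_iff {d : ℕ} {Ω : Type*} (N : Ω → ℕ∞) (X : ℕ → Ω → Space d)
    (R : ℕ → Ω → ℝ≥0) (x : Space d) (ω : Ω) :
    x ∉ booleanModel (N ω) (fun i => X i ω) (fun i => R i ω) ↔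
      ω ∈ avoidEvent N X R (coveringMarks x) := by
  simp [booleanModel, avoidEvent, coveringMarks]

/-! ### Full coverage has probability zero. -/

section Covering

variable {d : ℕ} {Ω : Type*} [MeasurableSpace Ω] {P : Measure Ω} [IsProbabilityMeasure P]
  {Λ : Ω → Measure (Space d)} {lam : ℝ≥0} {N : Ω → ℕ∞} {X : ℕ → Ω → Space d}
  {ν : Measure ℝ≥0} {R : ℕ → Ω → ℝ≥0}

lemma measure_avoidEvent_inter_le (hΛ : Measurable Λ) (hX : IsCoxProcess P Λ lam N X)
    (hR : IsIndependentMarking P Λ N X ν R) {G G' : Set (Space d × ℝ≥0)} (hG : MeasurableSet G)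
    (hG' : MeasurableSet G') :
    P (avoidEvent N X R G ∩ avoidEvent N X R G') ≤
      ∫⁻ ω, expNeg (lam * ∫⁻ y, ν (Prod.mk y ⁻¹' G) ∂(Λ ω)) *
        expNeg (lam * ∫⁻ y, ν (Prod.mk y ⁻¹' G') ∂(Λ ω)) ∂P +
      lam * ∫⁻ y, ν (Prod.mk y ⁻¹' (G ∩ G')) ∂(P.bind Λ) := by
  have := hR.isProbabilityMeasure
  have hset : avoidEvent N X R G ∩ avoidEvent N X R G' =
      Λ ⁻¹' Set.univ ∩ avoidEvent N X R (G ∪ G') := by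
    ext ω
    simp only [avoidEvent, Set.mem_inter_iff, Set.mem_ofPred_eq, Set.mem_union, not_or,
      Set.preimage_univ, Set.mem_univ, true_and]
    exact ⟨fun h i hi => ⟨h.1 i hi, h.2 i hi⟩,
      fun h => ⟨fun i hi => (h i hi).1, fun i hi => (h i hi).2⟩⟩
  have hφ : Measurable fun y => ν (Prod.mk y ⁻¹' (G ∩ G')) :=
    measurable_measure_prodMk_left (hG.inter hG')
  rw [hset, hX.measure_inter_avoidEvent hΛ hR (hG.union hG') MeasurableSet.univ,
    Set.preimage_univ, Measure.restrict_univ,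
    Measure.lintegral_bind hΛ.aemeasurable hφ.aemeasurable,
    ← lintegral_const_mul _ ((Measure.measurable_lintegral hφ).fun_comp hΛ), ← lintegral_add_left]
  · exact lintegral_mono fun ω => expNeg_union_le (Λ ω) ν lam hG hG'
  · exact (measurable_expNeg_lintegral hΛ (measurable_measure_prodMk_left hG)).mul
      (measurable_expNeg_lintegral hΛ (measurable_measure_prodMk_left hG'))

/-- The Boolean model of a Cox process whose radii have finite `d`-th moment almost surely leaves
some point uncovered. -/
theorem measure_booleanModel_eq_univ (hd : 1 ≤ d) (hΛ : IsStationaryNormalized P Λ)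
    (hX : IsCoxProcess P Λ lam N X) (hR : IsIndependentMarking P Λ N X ν R)
    (hν : ∫⁻ r, (r : ℝ≥0∞) ^ d ∂ν < ∞) :
    P {ω | booleanModel (N ω) (fun i => X i ω) (fun i => R i ω) = Set.univ} = 0 := by
  have := hR.isProbabilityMeasure
  have hHaar := isAddHaarMeasure_bind hΛ
  by_contra h0
  set C : Set Ω := {ω | booleanModel (N ω) (fun i => X i ω) (fun i => R i ω) = Set.univ}
  set h : Space d → Ω → ℝ≥0∞ := fun x ω => lam * ∫⁻ y, ν (Prod.mk y ⁻¹' coveringMarks x) ∂(Λ ω)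
    with hh
  set V : Space d → Set Ω := fun x => avoidEvent N X R (coveringMarks x)
  have hφm : ∀ x : Space d, Measurable fun y => ν (Prod.mk y ⁻¹' coveringMarks x) := fun x =>
    measurable_measure_prodMk_left (measurableSet_coveringMarks x)
  have hhm : ∀ x, Measurable (h x) := fun x =>
    measurable_const.mul ((Measure.measurable_lintegral (hφm x)).comp hΛ.measurable)
  have hem : ∀ x, Measurable fun ω => expNeg (h x ω) := fun x => measurable_expNeg.comp (hhm x)
  have hVm : ∀ x, MeasurableSet (V x) := fun x => measurableSet_avoidEvent hX.measurable_number
    hX.measurable_point hR.measurable (measurableSet_coveringMarks x)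
  set c : ℝ≥0∞ := lam * ((P.bind Λ) (Metric.ball 0 1) * ∫⁻ r, (r : ℝ≥0∞) ^ d ∂ν) with hc
  have hctop : c ≠ ∞ :=
    ENNReal.mul_ne_top ENNReal.coe_ne_top (ENNReal.mul_ne_top measure_ball_lt_top.ne hν.ne)
  have hmean : ∀ x, ∫⁻ ω, h x ω ∂P ≤ c := by
    intro x
    simp only [hh]
    rw [lintegral_const_mul _ ((Measure.measurable_lintegral (hφm x)).fun_comp hΛ.measurable),
      ← Measure.lintegral_bind hΛ.measurable.aemeasurable (hφm x).aemeasurable]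
    exact mul_le_mul_right (lintegral_coveringMarks_le _ ν x) _
  have hCtop : P C ≠ ∞ := measure_ne_top P C
  have hhalf : P C / 2 ≠ 0 := (ENNReal.half_pos h0).ne'
  -- With this level Markov discards at most half of `P C`; the added one keeps `M` nonzero.
  set M : ℝ≥0∞ := c / (P C / 2) + 1 with hM
  have hMtop : M ≠ ∞ := ENNReal.add_ne_top.2 ⟨ENNReal.div_ne_top hctop hhalf, ENNReal.one_ne_top⟩
  have hM0 : M ≠ 0 := by simp [hM]
  have hmarkov : ∀ x, P {ω | M ≤ h x ω} ≤ P C / 2 := by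
    intro x
    refine (meas_ge_le_lintegral_div (hhm x).aemeasurable hM0 hMtop).trans ?_
    refine (ENNReal.div_le_div_right (hmean x) M).trans ?_
    rw [ENNReal.div_le_iff hM0 hMtop, hM, mul_add,
      ENNReal.mul_div_cancel hhalf (ENNReal.div_ne_top hCtop two_ne_zero)]
    exact le_self_add
  set δ : ℝ := (expNeg M * (P C / 2)).toReal with hδ
  have hδtop : expNeg M * (P C / 2) ≠ ∞ :=
    ENNReal.mul_ne_top (expNeg_ne_top M) (ENNReal.div_ne_top hCtop two_ne_zero)
  have hδpos : 0 < δ := by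
    refine ENNReal.toReal_pos (mul_ne_zero ?_ hhalf) hδtop
    rw [expNeg_of_ne_top hMtop]
    exact (ENNReal.ofReal_pos.2 (Real.exp_pos _)).ne'
  have hlow : ∀ (A : Set Ω), MeasurableSet A → C ⊆ A → ∀ x,
      expNeg M * (P C / 2) ≤ ∫⁻ ω in A, expNeg (h x ω) ∂P := by
    intro A hA hCA x
    have hlt : MeasurableSet {ω | M ≤ h x ω} := measurableSet_le measurable_const (hhm x)
    have hPA : P C / 2 ≤ P (A \ {ω | M ≤ h x ω}) := by
      refine le_trans ?_ le_measure_sdiff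
      refine le_trans ?_ (tsub_le_tsub (measure_mono hCA) (hmarkov x))
      rw [ENNReal.sub_half hCtop]
    calc expNeg M * (P C / 2) ≤ expNeg M * P (A \ {ω | M ≤ h x ω}) := by gcongr
      _ = ∫⁻ _ in A \ {ω | M ≤ h x ω}, expNeg M ∂P := by rw [setLIntegral_const]
      _ ≤ ∫⁻ ω in A \ {ω | M ≤ h x ω}, expNeg (h x ω) ∂P :=
          setLIntegral_mono (hem x) fun ω hω => expNeg_antitone (not_le.1 hω.2).le
      _ ≤ ∫⁻ ω in A, expNeg (h x ω) ∂P := lintegral_mono_set Set.sdiff_subset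
  obtain ⟨K, hK⟩ := exists_forall_lintegral_coveringMarks_inter_le (P.bind Λ) ν hν
    (ε := ENNReal.ofReal (δ ^ 2 / 2) / lam)
    (ENNReal.div_pos (ENNReal.ofReal_pos.2 (by positivity)).ne' ENNReal.coe_ne_top)
  -- Points spaced `K` apart along the first coordinate axis.
  set x : ℕ → Space d := fun n => EuclideanSpace.single ⟨0, hd⟩ ((n * K : ℕ) : ℝ) with hx
  have hdist : ∀ n m, n ≠ m → (K : ℝ) ≤ dist (x n) (x m) := by
    intro n m hnm
    have h1 : (1 : ℝ) ≤ |(n : ℝ) - m| := by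
      have : (1 : ℤ) ≤ |(n : ℤ) - m| := Int.one_le_abs (sub_ne_zero.2 (by exact_mod_cast hnm))
      exact_mod_cast this
    rw [hx, PiLp.dist_single_same, Real.dist_eq]
    push_cast
    rw [← sub_mul, abs_mul, Nat.abs_cast]
    nlinarith [(Nat.cast_nonneg K : (0 : ℝ) ≤ K)]
  have hkey : δ ^ 2 ≤ δ ^ 2 / 2 := by
    -- Coverage of the countably many `x n` is a measurable event containing `C`, so measurability
    -- of `C` itself is not needed.
    have hA : MeasurableSet (⋂ n, (V (x n))ᶜ) := MeasurableSet.iInter fun n => (hVm (x n)).compl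
    have hCA : C ⊆ ⋂ n, (V (x n))ᶜ := by
      intro ω hω
      refine Set.mem_iInter.2 fun n hn => (notMem_booleanModel_iff N X R (x n) ω).2 hn ?_
      rw [show booleanModel (N ω) (fun i => X i ω) (fun i => R i ω) = Set.univ from hω]
      trivial
    have hpos : ∀ f : Ω → ℝ≥0∞, 0 ≤ᵐ[P] fun ω => (f ω).toReal :=
      fun f => .of_forall fun ω => ENNReal.toReal_nonneg
    have htop : ∀ n m ω, expNeg (h (x n) ω) * expNeg (h (x m) ω) < ∞ := fun n m ω =>
      ENNReal.mul_lt_top (expNeg_ne_top _).lt_top (expNeg_ne_top _).lt_top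
    have hpp : ∀ n m, ∫ ω, (expNeg (h (x n) ω)).toReal * (expNeg (h (x m) ω)).toReal ∂P =
        (∫⁻ ω, expNeg (h (x n) ω) * expNeg (h (x m) ω) ∂P).toReal := by
      intro n m
      simp_rw [← ENNReal.toReal_mul]
      exact integral_toReal ((hem _).mul (hem _)).aemeasurable (.of_forall (htop n m))
    have hppt : ∀ n m, ∫⁻ ω, expNeg (h (x n) ω) * expNeg (h (x m) ω) ∂P ≠ ∞ := by
      intro n m
      refine ((lintegral_mono (g := fun _ => 1) fun ω => ?_).trans_lt (by simp)).ne
      exact mul_le_one' (expNeg_le_one _) (expNeg_le_one _)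
    refine sq_le_of_second_moment (P := P) (A := ⋂ n, (V (x n))ᶜ)
      (Z := fun n => (V (x n)).indicator fun _ => 1)
      (p := fun n ω => (expNeg (h (x n) ω)).toReal)
      (fun n => measurable_const.indicator (hVm (x n))) (fun n => (hem (x n)).ennreal_toReal)
      (fun n ω => ?_) (fun n ω => ⟨ENNReal.toReal_nonneg, ?_⟩) hA
      (fun n ω hω => Set.indicator_of_notMem (Set.mem_iInter.1 hω n) _) (by positivity) hδpos.le
      (fun n m hnm => ?_) (fun n m => ?_) fun n => ?_
    · by_cases hω : ω ∈ V (x n) <;> simp [hω]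
    · exact ENNReal.toReal_le_of_le_ofReal zero_le_one (by simpa using expNeg_le_one _)
    · have hZZ : (fun ω => (V (x n)).indicator (fun _ => (1 : ℝ)) ω *
          (V (x m)).indicator (fun _ => (1 : ℝ)) ω) = (V (x n) ∩ V (x m)).indicator 1 := by
        rw [Set.inter_indicator_one]
        rfl
      rw [hZZ, integral_indicator_one ((hVm _).inter (hVm _)), hpp, Measure.real,
        ← ENNReal.toReal_ofReal (by positivity : 0 ≤ δ ^ 2 / 2),
        ← ENNReal.toReal_add (hppt n m) ENNReal.ofReal_ne_top]
      refine ENNReal.toReal_mono (ENNReal.add_ne_top.2 ⟨hppt n m, ENNReal.ofReal_ne_top⟩) ?_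
      refine (measure_avoidEvent_inter_le hΛ.measurable hX hR (measurableSet_coveringMarks _)
        (measurableSet_coveringMarks _)).trans ?_
      refine add_le_add le_rfl ((mul_le_mul_right (hK _ _ (hdist n m hnm)) _).trans ?_)
      exact ENNReal.mul_div_le
    · have hZp : (fun ω => (V (x n)).indicator (fun _ => (1 : ℝ)) ω *
          (expNeg (h (x m) ω)).toReal) =
          (V (x n)).indicator fun ω => (expNeg (h (x m) ω)).toReal := by
        funext ω
        by_cases hω : ω ∈ V (x n) <;> simp [hω]
      rw [hZp, integral_indicator (hVm _), hpp, integral_toReal (hem _).aemeasurable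
        (.of_forall fun ω => (expNeg_ne_top _).lt_top)]
      congr 1
      -- `p (x m)` is a function of `Λ`, so `Z n` may be replaced by its conditional probability.
      exact hX.setLIntegral_avoidEvent hΛ.measurable hR (measurableSet_coveringMarks (x n))
        (measurable_expNeg.comp (measurable_const.mul (Measure.measurable_lintegral (hφm (x m)))))
    · rw [integral_toReal (hem _).aemeasurable (.of_forall fun ω => (expNeg_ne_top _).lt_top), hδ]
      refine ENNReal.toReal_mono ?_ (hlow _ hA hCA (x n))
      exact ((lintegral_mono fun ω => expNeg_le_one _).trans_lt (by simp)).ne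
  nlinarith

end Covering

end CoxBoolean

theorem proposition1 (d : ℕ) (hd : 1 ≤ d)
    {Ω : Type*} [MeasurableSpace Ω] (P : Measure Ω) [IsProbabilityMeasure P]
    (Λ : Ω → Measure (CoxBoolean.Space d)) (hΛ : CoxBoolean.IsStationaryNormalized P Λ)
    (lam : ℝ≥0) (hlam : 0 < lam)
    (N : Ω → ℕ∞) (X : ℕ → Ω → CoxBoolean.Space d)
    (hX : CoxBoolean.IsCoxProcess P Λ lam N X)
    (ν : Measure ℝ≥0) (R : ℕ → Ω → ℝ≥0)
    (hR : CoxBoolean.IsIndependentMarking P Λ N X ν R)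
    (hν : ∫⁻ r, (r : ℝ≥0∞) ^ d ∂ν < ∞) :
    P {ω | CoxBoolean.booleanModel (N ω) (fun i => X i ω) (fun i => R i ω) = Set.univ} < 1 ∧
    (CoxBoolean.IsErgodic P Λ →
      P {ω | CoxBoolean.booleanModel (N ω) (fun i => X i ω) (fun i => R i ω) = Set.univ} = 0) := by
  have h0 := CoxBoolean.measure_booleanModel_eq_univ hd hΛ hX hR hν
  exact ⟨h0.trans_lt one_pos, fun _ => h0⟩
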